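/- **Setting.** Fix an integer $d\ge 1$. A state is an element $m\in\{0,1\}^d$ recording the last $d$ moves of a stock (oldest first; $1$ means up, $0$ means down). For $b=\pm1$ let $m_b$ (also $m_+$, $m_-$) be the state obtained from $m$ by deleting the oldest entry and appending $1$ if $b=1$ and $0$ if $b=-1$. The directed graph on the states with the edges $m\to m_+$ and $m\to m_-$ is the $d$-dimensional de Bruijn graph. Two experts are functions $q,r:\{0,1\}^d\to(-1,1)$ with $q(m)\ne r(m)$ for at least one $m$. **The game.** For final data $\varphi(\xi,\eta)$, final time $T$ and $\varepsilon>0$, the function $u^\varepsilon(t,m,\xi,\eta)$ is defined at the times $t\le T$ for which $(T-t)/\varepsilon^2$ is an integer, by $u^\varepsilon(T,m,\xi,\eta)=\varphi(\xi,\eta)$ and $$u^\varepsilon(t,m,\xi,\eta)=\min_{|f|\le1}\ \max_{b=\pm1}\ u^\varepsilon\bigl(t+\varepsilon^2,\,m_b,\,\xi+\varepsilon b[q(m)-r(m)],\,\eta+\varepsilon b[q(m)+r(m)-2f]\bigr).$$ **The market's linear program.** Let $C_d^*$ be the optimal value of the linear program: maximize $M$ over $M\in\mathbb R$ and $(\beta_m)\in\mathbb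 R^{\{0,1\}^d}$ subject to, for every simple cycle $s$ of the graph with $|s|$ edges, $$\sum_{m\in s}\bigl[(q(m)-r(m))^2-b_{s,m}\beta_m\bigr]\ \ge\ |s|\,M ,$$ where $b_{s,m}=+1$ if $s$ leaves $m$ by the edge to $m_+$ and $b_{s,m}=-1$ if $s$ leaves $m$ by the edge to $m_-$. **The PDE and the conditions on $u$.** Let $T_0<T$ and let $u(t,\xi,\eta)$ be continuous on $[T_0,T]\times\mathbb R^2$, with $$u_t+\tfrac12 C_d^*\Bigl\langle D^2u\,\frac{\nabla^\perp u}{u_\eta},\frac{\nabla^\perp u}{u_\eta}\Bigr\rangle=0\quad (T_0<t<T),\qquad u(T,\xi,\eta)=\varphi(\xi,\eta),$$ where $\nabla^\perp u=(-u_\eta,u_\xi)$ and $D^2u$ is the Hessian in $(\xi,\eta)$. Given constants $K$ and $c>0$, assume that on $(T_0,T)\times\mathbb R^2$: 1. the derivatives of $u$ in $(\xi,\eta)$ of orders $1$ to $4$ exist, are continuous in $(t,\xi,\eta)$ and are bounded by $K$; $u_t$ and its derivatives in $(\xi,\eta)$ of orders $1$ and $2$ exist, are continuous and are bounded by $K$;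 $u_{tt}$ exists, is continuous and is bounded by $K$; 2. $u_\eta>c$; 3. $|u_\xi|\le u_\eta$; 4. $u_t\le 0$. **Theorem.** For every $d\ge1$, $K$ and $c>0$ there are constants $C$ and $\varepsilon_0>0$, depending only on $d$, $K$ and $c$ (in particular independent of $\varepsilon$, $t$, $T_0$ and $T$), such that for all experts $q,r$ and all $T_0<T$, $\varphi$, $u$ as above, $$u^\varepsilon(t,m,\xi,\eta)\ \ge\ u(t,\xi,\eta)-C\,[(T-t)+\varepsilon]\,\varepsilon$$ for all $0<\varepsilon<\varepsilon_0$, all $t\in[T_0,T)$ such that $(T-t)/\varepsilon^2$ is an integer, all $\xi,\eta\in\mathbb R$ and all $m\in\{0,1\}^d$. -/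

import Mathlib

namespace StockGame

/-! ### States, market moves and the de Bruijn graph -/

/-- A state records the `d` most recent market moves, the oldest one first
(`true` is the move `+1`, `false` is the move `-1`). -/
abbrev State (d : ℕ) : Type := Fin d → Bool

/-- The numerical value `±1` of a market move. -/
def sgn (b : Bool) : ℝ := if b then 1 else -1

/-- The state that follows `m` when the market moves by `b`: the oldest move is forgotten and `b`
is appended. The edges of the de Bruijn graph are the pairs `(m, next m b)`. -/
def next {d : ℕ} (m : State d) (b : Bool) : State d :=
  fun i => if h : (i : ℕ) + 1 < d then m ⟨(i : ℕ) + 1, h⟩ else b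

/-- Admissible experts: all the bids lie strictly between `-1` and `1`, and the two experts differ
in at least one state. -/
structure Experts {d : ℕ} (q r : State d → ℝ) : Prop where
  abs_q_lt_one : ∀ m, |q m| < 1
  abs_r_lt_one : ∀ m, |r m| < 1
  distinct : ∃ m, q m ≠ r m

/-! ### The scaled game -/

/-- The scaled value function as a function of the number of steps that remain to be played.
With final time `T`, the function `u^ε(t, m, ξ, η)` at the time `t = T - n ε²` is
`value q r φ ε n m ξ η`. The recursion is the dynamic programming principle
`u^ε(t, m, ξ, η) = min_{|f| ≤ 1} max_{b = ±1}
  u^ε(t + ε², m_b, ξ + ε b [q(m) - r(m)], η + ε b [q(m) + r(m) - 2f])`. -/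
noncomputable def value {d : ℕ} (q r : State d → ℝ) (φ : ℝ → ℝ → ℝ) (ε : ℝ) :
    ℕ → State d → ℝ → ℝ → ℝ
  | 0, _, ξ, η => φ ξ η
  | n + 1, m, ξ, η =>
      sInf ((fun f : ℝ =>
        max
          (value q r φ ε n (next m true)
            (ξ + ε * sgn true * (q m - r m)) (η + ε * sgn true * (q m + r m - 2 * f)))
          (value q r φ ε n (next m false)
            (ξ + ε * sgn false * (q m - r m)) (η + ε * sgn false * (q m + r m - 2 * f))))
        '' Set.Icc (-1) 1)

theorem continuous_value {d : ℕ} (q r : State d → ℝ) {φ : ℝ → ℝ → ℝ}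
    (hφ : Continuous fun p : ℝ × ℝ => φ p.1 p.2) (ε : ℝ) (n : ℕ) :
    ∀ m, Continuous fun p : ℝ × ℝ => value q r φ ε n m p.1 p.2 := by
  induction n with
  | zero => intro m; simpa [value] using hφ
  | succ n ih =>
    intro m
    simp only [value]
    refine IsCompact.continuous_sInf isCompact_Icc ?_
    refine Continuous.max ?_ ?_
    · exact (ih (next m true)).comp
        (f := fun z : (ℝ × ℝ) × ℝ => (z.1.1 + ε * sgn true * (q m - r m),
          z.1.2 + ε * sgn true * (q m + r m - 2 * z.2))) (by fun_prop)
    · exact (ih (next m false)).comp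
        (f := fun z : (ℝ × ℝ) × ℝ => (z.1.1 + ε * sgn false * (q m - r m),
          z.1.2 + ε * sgn false * (q m + r m - 2 * z.2))) (by fun_prop)

/-- For continuous final data the infimum in the definition of `value` is a minimum. -/
theorem value_succ_isLeast {d : ℕ} (q r : State d → ℝ) {φ : ℝ → ℝ → ℝ}
    (hφ : Continuous fun p : ℝ × ℝ => φ p.1 p.2) (ε : ℝ) (n : ℕ) (m : State d) (ξ η : ℝ) :
    IsLeast ((fun f : ℝ =>
        max
          (value q r φ ε n (next m true)
            (ξ + ε * sgn true * (q m - r m)) (η + ε * sgn true * (q m + r m - 2 * f)))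
          (value q r φ ε n (next m false)
            (ξ + ε * sgn false * (q m - r m)) (η + ε * sgn false * (q m + r m - 2 * f))))
        '' Set.Icc (-1) 1) (value q r φ ε (n + 1) m ξ η) := by
  simp only [value]
  refine IsCompact.isLeast_sInf (isCompact_Icc.image ?_) ⟨_, 0, by simp, rfl⟩
  refine Continuous.max ?_ ?_
  · exact (continuous_value q r hφ ε n (next m true)).comp
      (f := fun f : ℝ => (ξ + ε * sgn true * (q m - r m),
        η + ε * sgn true * (q m + r m - 2 * f))) (by fun_prop)
  · exact (continuous_value q r hφ ε n (next m false)).comp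
      (f := fun f : ℝ => (ξ + ε * sgn false * (q m - r m),
        η + ε * sgn false * (q m + r m - 2 * f))) (by fun_prop)

/-! ### The market's linear program -/

/-- A simple cycle of the de Bruijn graph, with a starting vertex: a closed walk of positive length
whose vertices are distinct (except that the last one is the first one). The walk leaves
`vertex i` by the edge of the market move `move i`. Rotations of a cycle give the same row of the
linear program. -/
structure SimpleCycle (d : ℕ) where
  length : ℕ
  length_pos : 0 < length
  vertex : Fin length → State d
  move : Fin length → Bool
  vertex_injective : Function.Injective vertex
  step : ∀ i : Fin length,
    vertex ⟨((i : ℕ) + 1) % length, Nat.mod_lt _ length_pos⟩ = next (vertex i) (move i)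

/-- The entry of the constraint matrix in the row of the cycle `s` and the column of the state `m`:
`1` if `s` leaves `m` by the edge from `m` to `m₊`, `-1` if it leaves `m` by the edge to `m₋`, and
`0` if it does not pass through `m`. -/
noncomputable def cycleEntry {d : ℕ} (s : SimpleCycle d) (m : State d) : ℝ :=
  ∑ i : Fin s.length, if s.vertex i = m then sgn (s.move i) else 0

/-- The right-hand side of the constraint of the cycle `s`: minus the sum of `(q(m) - r(m))²` over
the vertices `m` of `s`. -/
noncomputable def cycleData {d : ℕ} (q r : State d → ℝ) (s : SimpleCycle d) : ℝ :=
  -∑ i : Fin s.length, (q (s.vertex i) - r (s.vertex i)) ^ 2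

/-- Feasibility of `(β, M)` for the market's linear program `A (-β, M)ᵀ ≥ g`, where the last column
of `A` consists of minus the lengths of the cycles. -/
def MarketFeasible {d : ℕ} (q r : State d → ℝ) (β : State d → ℝ) (M : ℝ) : Prop :=
  ∀ s : SimpleCycle d,
    (∑ m : State d, cycleEntry s m * (-β m)) + (-(s.length : ℝ)) * M ≥ cycleData q r s

/-- The optimal value `C_d^*` of the market's linear program: the maximal `M` among the feasible
points. -/
noncomputable def marketValue {d : ℕ} (q r : State d → ℝ) : ℝ :=
  sSup {M : ℝ | ∃ β : State d → ℝ, MarketFeasible q r β M}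

/-! ### The partial differential equation -/

/-- `∂u/∂t` for a function `u(t, ξ, η)`. -/
noncomputable def dt (u : ℝ → ℝ → ℝ → ℝ) : ℝ → ℝ → ℝ → ℝ :=
  fun t ξ η => deriv (fun s => u s ξ η) t

/-- `∂u/∂ξ` for a function `u(t, ξ, η)`. -/
noncomputable def dxi (u : ℝ → ℝ → ℝ → ℝ) : ℝ → ℝ → ℝ → ℝ :=
  fun t ξ η => deriv (fun x => u t x η) ξ

/-- `∂u/∂η` for a function `u(t, ξ, η)`. -/
noncomputable def deta (u : ℝ → ℝ → ℝ → ℝ) : ℝ → ℝ → ℝ → ℝ :=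
  fun t ξ η => deriv (fun y => u t ξ y) η

/-- The Hessian of `u` in the spatial variables `(ξ, η)`. -/
noncomputable def hessian (u : ℝ → ℝ → ℝ → ℝ) (t ξ η : ℝ) : Matrix (Fin 2) (Fin 2) ℝ :=
  !![dxi (dxi u) t ξ η, dxi (deta u) t ξ η;
     dxi (deta u) t ξ η, deta (deta u) t ξ η]

/-- The vector `∇^⊥ u / u_η`, where `∇^⊥ u = (-u_η, u_ξ)`. -/
noncomputable def perpGrad (u : ℝ → ℝ → ℝ → ℝ) (t ξ η : ℝ) : Fin 2 → ℝ :=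
  (deta u t ξ η)⁻¹ • ![-deta u t ξ η, dxi u t ξ η]

open scoped Matrix in
/-- `u` solves `u_t + (C/2) ⟨D²u ∇^⊥u/u_η, ∇^⊥u/u_η⟩ = 0` for `T₀ < t < T`, is continuous on
`[T₀, T] × ℝ²`, and has the final values `u(T, ξ, η) = φ(ξ, η)`. -/
structure SolvesPDE (C T₀ T : ℝ) (φ : ℝ → ℝ → ℝ) (u : ℝ → ℝ → ℝ → ℝ) : Prop where
  equation : ∀ t ∈ Set.Ioo T₀ T, ∀ ξ η : ℝ,
    dt u t ξ η
      + 1 / 2 * C * ((hessian u t ξ η *ᵥ perpGrad u t ξ η) ⬝ᵥ perpGrad u t ξ η) = 0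
  continuousOn : ContinuousOn (fun z : ℝ × ℝ × ℝ => u z.1 z.2.1 z.2.2)
    (Set.Icc T₀ T ×ˢ Set.univ)
  final : ∀ ξ η : ℝ, u T ξ η = φ ξ η

/-- The function `(ξ, η) ↦ w(t, ξ, η)` at a fixed time. -/
def slice (w : ℝ → ℝ → ℝ → ℝ) (t : ℝ) : ℝ × ℝ → ℝ := fun p => w t p.1 p.2

/-- On `(T₀, T) × ℝ²`, the spatial derivatives of `w(t, ξ, η)` of all the orders `k` with
`k₀ ≤ k ≤ k₁` exist, are continuous in `(t, ξ, η)`, and are bounded by `K`. -/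
structure SpatiallyRegular (T₀ T K : ℝ) (k₀ k₁ : ℕ) (w : ℝ → ℝ → ℝ → ℝ) : Prop where
  contDiff : ∀ t ∈ Set.Ioo T₀ T, ContDiff ℝ k₁ (slice w t)
  continuousOn : ∀ k ∈ Set.Icc k₀ k₁,
    ContinuousOn (fun z : ℝ × (ℝ × ℝ) => iteratedFDeriv ℝ k (slice w z.1) z.2)
      (Set.Ioo T₀ T ×ˢ Set.univ)
  bound : ∀ k ∈ Set.Icc k₀ k₁, ∀ t ∈ Set.Ioo T₀ T, ∀ p : ℝ × ℝ,
    ‖iteratedFDeriv ℝ k (slice w t) p‖ ≤ K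

/-- The smoothness and sign conditions on `u` for `T₀ < t < T`, with the common bound `K` for
all the derivatives and the lower bound `c` for `u_η`. The function `u` itself is not required to
be bounded. -/
structure Admissible (T₀ T K c : ℝ) (u : ℝ → ℝ → ℝ → ℝ) : Prop where
  spatial : SpatiallyRegular T₀ T K 1 4 u
  differentiable_time : ∀ t ∈ Set.Ioo T₀ T, ∀ ξ η : ℝ,
    DifferentiableAt ℝ (fun s => u s ξ η) t
  spatial_dt : SpatiallyRegular T₀ T K 0 2 (dt u)
  differentiable_time_dt : ∀ t ∈ Set.Ioo T₀ T, ∀ ξ η : ℝ,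
    DifferentiableAt ℝ (fun s => dt u s ξ η) t
  continuousOn_dtt : ContinuousOn (fun z : ℝ × ℝ × ℝ => dt (dt u) z.1 z.2.1 z.2.2)
    (Set.Ioo T₀ T ×ˢ Set.univ)
  bound_dtt : ∀ t ∈ Set.Ioo T₀ T, ∀ ξ η : ℝ, |dt (dt u) t ξ η| ≤ K
  deta_gt : ∀ t ∈ Set.Ioo T₀ T, ∀ ξ η : ℝ, c < deta u t ξ η
  abs_dxi_le : ∀ t ∈ Set.Ioo T₀ T, ∀ ξ η : ℝ, |dxi u t ξ η| ≤ deta u t ξ η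
  dt_nonpos : ∀ t ∈ Set.Ioo T₀ T, ∀ ξ η : ℝ, dt u t ξ η ≤ 0

end StockGame

/-! The value of the linear program is the plain mean A of (q - r)² over all states. The simple
random walk on the de Bruijn graph preserves the uniform measure and forgets its start after d
steps. So with P its averaging operator, the Poisson equation Pa - a = 1 - (q - r)²/A has a solution
with |a| ≤ d·2^d, uniformly in the experts (`exists_corrector`). Its differences a(m₊) - a(m₋) give
β for which every cycle constraint is an equality with M = A. Conversely, `rotate false` and `rotate
true` are permutations of the states that together use every edge once; adding the constraints along
their cycles cancels β and gives M ≤ A (`marketValue_eq_mean`).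

For the game, the value function is compared with the corrected function u - ε² u_t a(m). In the
expansion along a move b, the part even in b cancels up to O(ε³) by the PDE and the Poisson
equation, if the second variation is taken in the direction tangent to the level set of u. The part
odd in b is ±X, where X = εG - ε² u_t (a(m₊) - a(m₋))/2 and G is the first variation; the market
picks the sign that gains |X|. An f with G ≠ 0 moves the second variation off the tangent one by
O(|G|). The resulting cost O(ε²|G|) is paid by |X| up to O(ε³) once ε is small (`fine_step`).

The loss is O(ε³) per step, hence O((T - t)ε) over (T - t)/ε² steps. The derivatives are controlled
only for T₀ < t < T, so a step touching T₀ or T uses the cruder `coarse_step`, at a cost O(ε²)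
incurred at most twice. -/

namespace StockGame

/-! ### The discrete part: averaging over the de Bruijn graph and the value of the linear program -/

section Discrete

variable {d : ℕ}

/-- The squared difference of the two experts. -/
noncomputable def gap (q r : State d → ℝ) (m : State d) : ℝ := (q m - r m) ^ 2

/-- The mean of a function over all the states. -/
noncomputable def mean (g : State d → ℝ) : ℝ := (∑ m, g m) / 2 ^ d

/-- The averaging operator of the simple random walk on the de Bruijn graph. -/
noncomputable def walkAverage (g : State d → ℝ) (m : State d) : ℝ :=
  (g (next m true) + g (next m false)) / 2

/-- The move by `m 0`, or by its negation: a permutation of the states. -/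
def rotate [NeZero d] (c : Bool) (m : State d) : State d := next m (xor (m 0) c)

/-- The appended entry `xor (m 0) c` still encodes the forgotten `m 0`, and the shift keeps every
other entry. -/
theorem rotate_injective [NeZero d] (c : Bool) :
    Function.Injective (rotate c : State d → State d) := by
  intro m m' h
  have key : ∀ i : Fin d, rotate c m i = rotate c m' i := fun i => congrFun h i
  have hd : 0 < d := Nat.pos_of_ne_zero (NeZero.ne d)
  funext i
  by_cases hi : (i : ℕ) = 0
  · have h1 := key ⟨d - 1, by omega⟩
    have h2 : ¬ (d - 1 + 1 < d) := by omega
    simp only [rotate, next, h2, dite_false] at h1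
    have hi0 : i = 0 := Fin.ext (by simpa using hi)
    rw [hi0]
    simpa using h1
  · have h1 := key ⟨(i : ℕ) - 1, by omega⟩
    have h2 : (i : ℕ) - 1 + 1 < d := by omega
    have h3 : (⟨(i : ℕ) - 1 + 1, h2⟩ : Fin d) = i := Fin.ext (by simp; omega)
    simpa only [rotate, next, h2, dite_true, h3] using h1

theorem sum_comp_rotate [NeZero d] (c : Bool) (g : State d → ℝ) :
    ∑ m, g (rotate c m) = ∑ m, g m :=
  Function.Bijective.sum_comp (Finite.injective_iff_bijective.mp (rotate_injective c)) g

/-- For each `m` the two values of `c` produce the two moves in some order, so the two permutations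
together traverse each edge exactly once. -/
theorem sum_rotate_eq_sum_next [NeZero d] (g : State d → Bool → ℝ) :
    ∑ m, g m (xor (m 0) false) + ∑ m, g m (xor (m 0) true)
      = ∑ m, (g m true + g m false) := by
  rw [← Finset.sum_add_distrib]
  refine Finset.sum_congr rfl fun m _ => ?_
  cases m 0 <;> simp [add_comm]

theorem sum_walkAverage [NeZero d] (g : State d → ℝ) :
    ∑ m, walkAverage g m = ∑ m, g m := by
  have h := sum_rotate_eq_sum_next (fun m b => g (next m b))
  have h1 := sum_comp_rotate false g
  have h2 := sum_comp_rotate true g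
  simp only [rotate] at h1 h2
  rw [h1, h2] at h
  simp only [walkAverage, ← Finset.sum_div]
  linarith

/-- Each step pushes out the oldest entry, so after `k` random moves only the entries of index at
least `k` still matter; for `k = d` nothing remains. -/
theorem iterate_walkAverage_congr (g : State d → ℝ) (k : ℕ) :
    ∀ m m' : State d, (∀ i : Fin d, k ≤ i → m i = m' i) →
      walkAverage^[k] g m = walkAverage^[k] g m' := by
  induction k with
  | zero =>
    intro m m' h
    rw [show m = m' from funext fun i => h i (Nat.zero_le _)]
  | succ k ih =>
    intro m m' h
    simp only [Function.iterate_succ_apply']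
    have key : ∀ b, walkAverage^[k] g (next m b) = walkAverage^[k] g (next m' b) := by
      intro b
      refine ih _ _ fun i hi => ?_
      simp only [next]
      split_ifs with hid
      · exact h _ (by simpa using hi)
      · rfl
    simp only [walkAverage] at key ⊢
    rw [key, key]

theorem sum_iterate_walkAverage [NeZero d] (g : State d → ℝ) (k : ℕ) :
    ∑ m, walkAverage^[k] g m = ∑ m, g m := by
  induction k with
  | zero => rfl
  | succ k ih => simp only [Function.iterate_succ_apply', sum_walkAverage, ih]

theorem iterate_walkAverage_eq_mean [NeZero d] (g : State d → ℝ) (m : State d) :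
    walkAverage^[d] g m = mean g := by
  have h : ∀ m', walkAverage^[d] g m' = walkAverage^[d] g m := fun m' =>
    iterate_walkAverage_congr g d _ _ fun i hi => absurd i.2 (by omega)
  have hs := sum_iterate_walkAverage g d
  simp only [h] at hs
  rw [mean, ← hs]
  simp

theorem abs_iterate_walkAverage_le {g : State d → ℝ} {B : ℝ} (h : ∀ m, |g m| ≤ B) (k : ℕ) :
    ∀ m, |walkAverage^[k] g m| ≤ B := by
  induction k with
  | zero => exact h
  | succ k ih =>
    intro m
    simp only [Function.iterate_succ_apply', walkAverage]
    have h1 := abs_le.mp (ih (next m true))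
    have h2 := abs_le.mp (ih (next m false))
    rw [abs_le]
    constructor <;> linarith [h1.1, h1.2, h2.1, h2.2]

/-- The Poisson equation on the de Bruijn graph is solvable for functions of mean zero. -/
theorem exists_poisson [NeZero d] {h : State d → ℝ} {B : ℝ} (hB : ∀ m, |h m| ≤ B)
    (h0 : mean h = 0) :
    ∃ a : State d → ℝ, (∀ m, |a m| ≤ d * B) ∧ ∀ m, walkAverage a m - a m = h m := by
  -- The Neumann series of the averaging operator stops after `d` terms, since its `d`-th power
  -- sends a function of mean zero to 0.
  refine ⟨fun m => -∑ k ∈ Finset.range d, walkAverage^[k] h m, fun m => ?_, fun m => ?_⟩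
  · rw [abs_neg]
    refine (Finset.abs_sum_le_sum_abs _ _).trans ?_
    refine (Finset.sum_le_sum fun k _ => abs_iterate_walkAverage_le hB k m).trans ?_
    simp
  · have h1 : walkAverage (fun m => -∑ k ∈ Finset.range d, walkAverage^[k] h m) m
        = -∑ k ∈ Finset.range d, walkAverage^[k + 1] h m := by
      simp only [Function.iterate_succ_apply', walkAverage, ← Finset.sum_div,
        Finset.sum_add_distrib]
      ring
    rw [h1]
    have h2 := Finset.sum_range_sub (fun k => walkAverage^[k] h m) d
    rw [Finset.sum_sub_distrib, iterate_walkAverage_eq_mean, h0] at h2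
    simp only [Function.iterate_zero, id] at h2
    linarith

/-! ### The corrector -/

theorem mean_gap_pos {q r : State d → ℝ} (hqr : Experts q r) : 0 < mean (gap q r) := by
  obtain ⟨m, hm⟩ := hqr.distinct
  have hpos : 0 < gap q r m := by
    have := sub_ne_zero.mpr hm
    unfold gap
    positivity
  exact div_pos (Finset.sum_pos' (fun _ _ => sq_nonneg _) ⟨m, Finset.mem_univ _, hpos⟩)
    (by positivity)

/-- A single squared gap is at most the sum of all of them, which is 2^d times the mean. This keeps
the bound on `a`, and so the final constants, independent of the experts. -/
theorem exists_corrector [NeZero d] {q r : State d → ℝ} (hqr : Experts q r) :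
    ∃ a : State d → ℝ, (∀ m, |a m| ≤ d * 2 ^ d) ∧
      ∀ m, walkAverage a m - a m = 1 - gap q r m / mean (gap q r) := by
  have hA := mean_gap_pos hqr
  have hpow : (1 : ℝ) ≤ 2 ^ d := one_le_pow₀ (by norm_num)
  refine exists_poisson (fun m => ?_) ?_
  · have h0 : 0 ≤ gap q r m / mean (gap q r) := div_nonneg (sq_nonneg _) hA.le
    have h1 : gap q r m / mean (gap q r) ≤ 2 ^ d := by
      rw [div_le_iff₀ hA, mean, mul_div_cancel₀ _ (by positivity)]
      exact Finset.single_le_sum (f := gap q r) (fun _ _ => sq_nonneg _) (Finset.mem_univ m)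
    rw [abs_le]
    constructor <;> linarith
  · have h1 : ∑ m : State d, gap q r m = mean (gap q r) * 2 ^ d := by
      rw [mean, div_mul_cancel₀ _ (by positivity)]
    rw [mean, Finset.sum_sub_distrib, ← Finset.sum_div, h1]
    simp
    field_simp
    simp

/-! ### The optimal value of the linear program -/

theorem sum_cycleEntry_mul (s : SimpleCycle d) (β : State d → ℝ) :
    ∑ m, cycleEntry s m * (-β m) = -∑ i, sgn (s.move i) * β (s.vertex i) := by
  simp only [cycleEntry, Finset.sum_mul]
  rw [Finset.sum_comm, ← Finset.sum_neg_distrib]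
  refine Finset.sum_congr rfl fun i _ => ?_
  simp [ite_mul]

theorem marketFeasible_iff {q r β : State d → ℝ} {M : ℝ} :
    MarketFeasible q r β M ↔ ∀ s : SimpleCycle d,
      0 ≤ ∑ i, (gap q r (s.vertex i) - sgn (s.move i) * β (s.vertex i) - M) := by
  refine forall_congr' fun s => ?_
  rw [sum_cycleEntry_mul, cycleData]
  simp only [Finset.sum_sub_distrib, gap]
  simp only [Finset.sum_const, Finset.card_univ, Fintype.card_fin, nsmul_eq_mul, ge_iff_le]
  constructor <;> intro h <;> linarith

/-- Advancing by one edge permutes the vertices of a cycle, so potential differences sum to zero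
around it. -/
theorem sum_cycle_step (s : SimpleCycle d) (a : State d → ℝ) :
    ∑ i, a (next (s.vertex i) (s.move i)) = ∑ i, a (s.vertex i) := by
  simp only [← s.step]
  let e : Fin s.length → Fin s.length :=
    fun i => ⟨((i : ℕ) + 1) % s.length, Nat.mod_lt _ s.length_pos⟩
  have he : Function.Injective e := by
    intro i j hij
    have h : ((i : ℕ) + 1) % s.length = ((j : ℕ) + 1) % s.length := congrArg Fin.val hij
    have h2 : (i : ℕ) ≡ j [MOD s.length] := Nat.ModEq.add_right_cancel' 1 h
    exact Fin.ext (h2.eq_of_lt_of_lt i.2 j.2)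
  exact Function.Bijective.sum_comp (Finite.injective_iff_bijective.mp he)
    (fun i => a (s.vertex i))

theorem exists_marketFeasible_mean [NeZero d] {q r : State d → ℝ} (hqr : Experts q r) :
    ∃ β, MarketFeasible q r β (mean (gap q r)) := by
  obtain ⟨a, -, ha⟩ := exists_corrector hqr
  have hA := mean_gap_pos hqr
  set A := mean (gap q r)
  -- This choice makes the slack of each edge A times the drop of the potential `a` along it, so the
  -- slack vanishes around every cycle.
  refine ⟨fun m => A * ((a (next m true) - a (next m false)) / 2), ?_⟩
  rw [marketFeasible_iff]
  intro s
  have key : ∀ m b, gap q r m - sgn b * (A * ((a (next m true) - a (next m false)) / 2)) - A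
      = A * (a m - a (next m b)) := by
    intro m b
    have h := ha m
    have h1 : gap q r m = A * (1 - (walkAverage a m - a m)) := by
      rw [h]; field_simp; ring
    rw [h1]
    cases b <;> simp [sgn, walkAverage] <;> ring
  simp only [key, ← Finset.mul_sum, Finset.sum_sub_distrib, sum_cycle_step]
  simp

/-- The cycle of the permutation `rotate c` through `m`. -/
noncomputable def rotateCycle [NeZero d] (c : Bool) (m : State d) : SimpleCycle d where
  length := Function.minimalPeriod (rotate c) m
  length_pos := Function.minimalPeriod_pos_of_mem_periodicPts
    ((rotate_injective c).mem_periodicPts m)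
  vertex i := (rotate c)^[i] m
  move i := xor ((rotate c)^[i] m 0) c
  vertex_injective := by
    intro i j h
    exact Fin.ext (Function.iterate_injOn_Iio_minimalPeriod i.2 j.2 h)
  step i := by
    simp only [Function.iterate_mod_minimalPeriod_eq, Function.iterate_succ_apply']
    rfl

/-- Instead of splitting the states into orbits, every orbit is followed for a common multiple `n`
of the periods. Summed over all starting states this gives `n` times the total, because each iterate
is a permutation. -/
theorem sum_rotate_nonneg [NeZero d] (c : Bool) {w : State d → ℝ}
    (h : ∀ m, 0 ≤ ∑ i ∈ Finset.range (Function.minimalPeriod (rotate c) m), w ((rotate c)^[i] m)) :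
    0 ≤ ∑ m, w m := by
  have hnn : ∀ m k, 0 ≤ ∑ i ∈ Finset.range (Function.minimalPeriod (rotate c) m * k),
      w ((rotate c)^[i] m) := by
    intro m k
    induction k with
    | zero => simp
    | succ k ih =>
      rw [Nat.mul_succ, Finset.sum_range_add]
      refine add_nonneg ih ?_
      refine (h m).trans_eq (Finset.sum_congr rfl fun i _ => ?_)
      rw [add_comm, Function.iterate_add_apply,
        ((Function.isPeriodicPt_minimalPeriod (rotate c) m).mul_const k).eq]
  have hex : ∃ n, 0 < n ∧ ∀ m, Function.minimalPeriod (rotate c : State d → State d) m ∣ n := by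
    refine ⟨∏ m, Function.minimalPeriod (rotate c : State d → State d) m, ?_, fun m =>
      Finset.dvd_prod_of_mem _ (Finset.mem_univ m)⟩
    exact Finset.prod_pos fun m _ => Function.minimalPeriod_pos_of_mem_periodicPts
      ((rotate_injective c).mem_periodicPts m)
  obtain ⟨n, hn, hdvd⟩ := hex
  have hsum : 0 ≤ ∑ m, ∑ i ∈ Finset.range n, w ((rotate c)^[i] m) := by
    refine Finset.sum_nonneg fun m _ => ?_
    obtain ⟨k, hk⟩ := hdvd m
    rw [hk]
    exact hnn m k
  have hit : ∀ i, ∑ m, w ((rotate c)^[i] m) = ∑ m, w m := fun i =>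
    Function.Bijective.sum_comp
      (Finite.injective_iff_bijective.mp ((rotate_injective c).iterate i)) w
  rw [Finset.sum_comm] at hsum
  simp only [hit, Finset.sum_const, Finset.card_range, nsmul_eq_mul] at hsum
  exact nonneg_of_mul_nonneg_right hsum (by exact_mod_cast hn)

theorem le_mean_of_marketFeasible [NeZero d] {q r β : State d → ℝ} {M : ℝ}
    (h : MarketFeasible q r β M) : M ≤ mean (gap q r) := by
  rw [marketFeasible_iff] at h
  have key : ∀ c : Bool, 0 ≤ ∑ m : State d, (gap q r m - sgn (xor (m 0) c) * β m - M) := by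
    intro c
    refine sum_rotate_nonneg c fun m => ?_
    have := h (rotateCycle c m)
    rw [Finset.sum_range]
    exact this
  -- Each state is now left once by each of its two edges, so `β` enters with both signs and
  -- cancels.
  have h1 := sum_rotate_eq_sum_next (fun m b => gap q r m - sgn b * β m - M)
  have h2 : 0 ≤ ∑ m : State d, (2 * (gap q r m - M)) := by
    calc 0 ≤ _ := add_nonneg (key false) (key true)
      _ = _ := h1
      _ = _ := Finset.sum_congr rfl fun m _ => by simp [sgn]; ring
  rw [← Finset.mul_sum, Finset.sum_sub_distrib] at h2
  rw [mean, le_div_iff₀ (by positivity)]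
  simp at h2
  linarith

theorem marketValue_eq_mean [NeZero d] {q r : State d → ℝ} (hqr : Experts q r) :
    marketValue q r = mean (gap q r) :=
  IsGreatest.csSup_eq ⟨exists_marketFeasible_mean hqr, fun _ ⟨_, h⟩ => le_mean_of_marketFeasible h⟩

end Discrete

/-! ### Taylor expansions -/

section Taylor

set_option maxSynthPendingDepth 3

variable {E : Type*} [NormedAddCommGroup E] [NormedSpace ℝ E]

theorem abs_add_sub_le_of_hasFDerivAt {G : E → ℝ} {G' : E → E →L[ℝ] ℝ} {x h : E} {C : ℝ}
    (hG : ∀ y, HasFDerivAt G (G' y) y) (hC : ∀ y, ‖y - x‖ ≤ ‖h‖ → ‖G' y‖ ≤ C) :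
    |G (x + h) - G x| ≤ C * ‖h‖ := by
  have := (convex_closedBall x ‖h‖).norm_image_sub_le_of_norm_hasFDerivWithin_le
    (f := G) (f' := G') (C := C) (x := x) (y := x + h)
    (fun y _ => (hG y).hasFDerivWithinAt)
    (fun y hy => hC y (by simpa [dist_eq_norm] using hy)) (by simp) (by simp)
  simpa using this

theorem norm_sub_le_of_norm_fderiv_le {V : Type*} [NormedAddCommGroup V] [NormedSpace ℝ V]
    {F : E → V} {K : ℝ} (hF : ContDiff ℝ 1 F) (hK : ∀ p, ‖fderiv ℝ F p‖ ≤ K) (x y : E) :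
    ‖F y - F x‖ ≤ K * ‖y - x‖ :=
  convex_univ.norm_image_sub_le_of_norm_fderiv_le
    (fun p _ => (hF.differentiable (by norm_num)) p) (fun p _ => hK p) trivial trivial

variable {F : E → ℝ} {K : ℝ}

theorem abs_taylor_one_le (hF : ContDiff ℝ 2 F) (hK : ∀ p, ‖fderiv ℝ (fderiv ℝ F) p‖ ≤ K)
    (x h : E) : |F (x + h) - F x - fderiv ℝ F x h| ≤ K * ‖h‖ ^ 2 := by
  have hK0 : 0 ≤ K := (norm_nonneg (fderiv ℝ (fderiv ℝ F) x)).trans (hK x)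
  have hd : ∀ y, HasFDerivAt (fun y => F y - fderiv ℝ F x y) (fderiv ℝ F y - fderiv ℝ F x) y :=
    fun y => ((hF.differentiable (by norm_num)) y).hasFDerivAt.sub
      (fderiv ℝ F x).hasFDerivAt
  have h2 := abs_add_sub_le_of_hasFDerivAt (x := x) (h := h) (C := K * ‖h‖) hd (fun y hy =>
    (norm_sub_le_of_norm_fderiv_le (hF.fderiv_right (by norm_num)) hK x y).trans (mul_le_mul_of_nonneg_left hy hK0))
  rw [map_add] at h2
  refine (le_of_eq (congrArg abs ?_)).trans (h2.trans (le_of_eq ?_)) <;> ring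

/-- The mean value inequality is applied first to the gradient and then to the function, which gives
the constant `K` in place of the sharp `K / 6`. -/
theorem abs_taylor_two_le (hF : ContDiff ℝ 3 F)
    (hK : ∀ p, ‖fderiv ℝ (fderiv ℝ (fderiv ℝ F)) p‖ ≤ K) (x h : E) :
    |F (x + h) - F x - fderiv ℝ F x h - 1 / 2 * fderiv ℝ (fderiv ℝ F) x h h| ≤ K * ‖h‖ ^ 3 := by
  have hK0 : 0 ≤ K := (norm_nonneg _).trans (hK x)
  have hF1 : ContDiff ℝ 2 (fderiv ℝ F) := hF.fderiv_right (by norm_num)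
  have hF2 : ContDiff ℝ 1 (fderiv ℝ (fderiv ℝ F)) := hF1.fderiv_right (by norm_num)
  set B := fderiv ℝ (fderiv ℝ F) x with hB
  have hsymm : ∀ v w, B v w = B w v := fun v w =>
    (hF.contDiffAt.isSymmSndFDerivAt (x := x) (by simp; norm_num)) v w
  have hgrad : ∀ y, ‖y - x‖ ≤ ‖h‖ →
      ‖fderiv ℝ F y - fderiv ℝ F x - B (y - x)‖ ≤ K * ‖h‖ ^ 2 := by
    intro y hy
    have := (convex_closedBall x ‖h‖).norm_image_sub_le_of_norm_hasFDerivWithin_le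
      (f := fun z => fderiv ℝ F z - B (z - x)) (f' := fun z => fderiv ℝ (fderiv ℝ F) z - B)
      (C := K * ‖h‖) (x := x) (y := y)
      (fun z _ => (((hF1.differentiable (by norm_num)) z).hasFDerivAt.sub
        (B.hasFDerivAt.comp z ((hasFDerivAt_id z).sub_const x))).hasFDerivWithinAt)
      (fun z hz => (norm_sub_le_of_norm_fderiv_le hF2 hK x z).trans
        (mul_le_mul_of_nonneg_left (by simpa [dist_eq_norm] using hz) hK0)) (by simp)
        (by simpa [dist_eq_norm] using hy)
    simp only [sub_self, map_zero, sub_zero] at this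
    rw [sub_right_comm]
    refine this.trans ?_
    rw [pow_two, ← mul_assoc]
    exact mul_le_mul_of_nonneg_left hy (by positivity)
  -- Symmetry of the second derivative is what makes the gradient of the quadratic term equal to `B
  -- (y - x)`.
  have hd : ∀ y, HasFDerivAt
      (fun y => F y - fderiv ℝ F x y - 1 / 2 * B (y - x) (y - x))
      (fderiv ℝ F y - fderiv ℝ F x - B (y - x)) y := by
    intro y
    have hid : HasFDerivAt (fun y : E => y - x) (ContinuousLinearMap.id ℝ E) y :=
      (hasFDerivAt_id y).sub_const x
    have h1 := ((B.hasFDerivAt.comp y hid).clm_apply hid).const_mul (1 / 2)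
    have h2 := (((hF.differentiable (by norm_num)) y).hasFDerivAt.sub
      (fderiv ℝ F x).hasFDerivAt).sub h1
    refine h2.congr_fderiv ?_
    ext v
    simp [hsymm v y, hsymm v x]
    ring
  have h2 := abs_add_sub_le_of_hasFDerivAt (x := x) (h := h) hd hgrad
  simp only [map_add, sub_self, add_sub_cancel_left, map_zero] at h2
  refine (le_of_eq (congrArg abs ?_)).trans (h2.trans (le_of_eq ?_)) <;> ring
end Taylor

/-! ### Spatial derivatives of functions of `(t, ξ, η)` -/

section Spatial

variable {u : ℝ → ℝ → ℝ → ℝ} {t : ℝ}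

theorem hasDerivAt_slice_left {w : ℝ × ℝ → ℝ} {ξ η : ℝ} (h : DifferentiableAt ℝ w (ξ, η)) :
    HasDerivAt (fun x => w (x, η)) (fderiv ℝ w (ξ, η) (1, 0)) ξ :=
  h.hasFDerivAt.comp_hasDerivAt ξ ((hasDerivAt_id ξ).prodMk (hasDerivAt_const ξ η))

theorem hasDerivAt_slice_right {w : ℝ × ℝ → ℝ} {ξ η : ℝ} (h : DifferentiableAt ℝ w (ξ, η)) :
    HasDerivAt (fun y => w (ξ, y)) (fderiv ℝ w (ξ, η) (0, 1)) η :=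
  h.hasFDerivAt.comp_hasDerivAt η ((hasDerivAt_const η ξ).prodMk (hasDerivAt_id η))

theorem dxi_eq (h : Differentiable ℝ (slice u t)) (ξ η : ℝ) :
    dxi u t ξ η = fderiv ℝ (slice u t) (ξ, η) (1, 0) :=
  (hasDerivAt_slice_left (h (ξ, η))).deriv

theorem deta_eq (h : Differentiable ℝ (slice u t)) (ξ η : ℝ) :
    deta u t ξ η = fderiv ℝ (slice u t) (ξ, η) (0, 1) :=
  (hasDerivAt_slice_right (h (ξ, η))).deriv

theorem fderiv_slice_apply (h : Differentiable ℝ (slice u t)) (ξ η : ℝ) (v : ℝ × ℝ) :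
    fderiv ℝ (slice u t) (ξ, η) v = v.1 * dxi u t ξ η + v.2 * deta u t ξ η := by
  rw [dxi_eq h, deta_eq h, ← smul_eq_mul, ← smul_eq_mul, ← map_smul, ← map_smul, ← map_add]
  simp

theorem fderiv_fderiv_apply {F : ℝ × ℝ → ℝ} (h : ContDiff ℝ 2 F) (p v w : ℝ × ℝ) :
    fderiv ℝ (fun y => fderiv ℝ F y v) p w = fderiv ℝ (fderiv ℝ F) p w v := by
  have h1 : ContDiff ℝ 1 (fderiv ℝ F) := h.fderiv_right (by norm_num)
  rw [fderiv_clm_apply ((h1.differentiable (by norm_num)) p) (differentiableAt_const v)]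
  simp

theorem hessian_form_eq (h : ContDiff ℝ 2 (slice u t)) (ξ η : ℝ) (w : Fin 2 → ℝ) :
    (hessian u t ξ η).mulVec w ⬝ᵥ w
      = fderiv ℝ (fderiv ℝ (slice u t)) (ξ, η) (w 0, w 1) (w 0, w 1) := by
  have hd : Differentiable ℝ (slice u t) := h.differentiable (by norm_num)
  have h1 : ContDiff ℝ 1 (fderiv ℝ (slice u t)) := h.fderiv_right (by norm_num)
  have hcomp : ∀ v : ℝ × ℝ, Differentiable ℝ fun y => fderiv ℝ (slice u t) y v := fun v =>
    (h1.clm_apply contDiff_const).differentiable (by norm_num)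
  have hsx : slice (dxi u) t = fun y => fderiv ℝ (slice u t) y (1, 0) :=
    funext fun y => dxi_eq hd y.1 y.2
  have hse : slice (deta u) t = fun y => fderiv ℝ (slice u t) y (0, 1) :=
    funext fun y => deta_eq hd y.1 y.2
  have hxx : dxi (dxi u) t ξ η = fderiv ℝ (fderiv ℝ (slice u t)) (ξ, η) (1, 0) (1, 0) := by
    rw [dxi_eq (hsx ▸ hcomp _), hsx, fderiv_fderiv_apply h]
  have hxe : dxi (deta u) t ξ η = fderiv ℝ (fderiv ℝ (slice u t)) (ξ, η) (1, 0) (0, 1) := by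
    rw [dxi_eq (hse ▸ hcomp _), hse, fderiv_fderiv_apply h]
  have hee : deta (deta u) t ξ η = fderiv ℝ (fderiv ℝ (slice u t)) (ξ, η) (0, 1) (0, 1) := by
    rw [deta_eq (hse ▸ hcomp _), hse, fderiv_fderiv_apply h]
  have hsymm := (h.contDiffAt.isSymmSndFDerivAt (x := (ξ, η)) (by simp)) (1, 0) (0, 1)
  have hw : ((w 0, w 1) : ℝ × ℝ) = w 0 • (1, 0) + w 1 • (0, 1) := by simp
  rw [hw]
  simp only [map_add, map_smul, add_apply, smul_apply,
    smul_eq_mul, ← hsymm, hessian, hxx, hxe, hee]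
  simp [Matrix.mulVec, dotProduct, Fin.sum_univ_two]
  ring

end Spatial

/-! ### Estimates for admissible functions -/

section Estimates

set_option maxSynthPendingDepth 3

theorem norm_prodMk_le {a b C : ℝ} (ha : |a| ≤ C) (hb : |b| ≤ C) : ‖((a, b) : ℝ × ℝ)‖ ≤ C := by
  rw [Prod.norm_mk]
  exact max_le ha hb

namespace Admissible

variable {T₀ T K c : ℝ} {u : ℝ → ℝ → ℝ → ℝ} {t : ℝ}

theorem contDiff_slice (h : Admissible T₀ T K c u) (ht : t ∈ Set.Ioo T₀ T) :
    ContDiff ℝ 3 (slice u t) :=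
  (h.spatial.contDiff t ht).of_le (by norm_num)

theorem norm_fderiv_two_le (h : Admissible T₀ T K c u) (ht : t ∈ Set.Ioo T₀ T) (p : ℝ × ℝ) :
    ‖fderiv ℝ (fderiv ℝ (slice u t)) p‖ ≤ K := by
  rw [← norm_iteratedFDeriv_one, norm_iteratedFDeriv_fderiv]
  exact h.spatial.bound 2 (by simp) t ht p

theorem norm_fderiv_three_le (h : Admissible T₀ T K c u) (ht : t ∈ Set.Ioo T₀ T) (p : ℝ × ℝ) :
    ‖fderiv ℝ (fderiv ℝ (fderiv ℝ (slice u t))) p‖ ≤ K := by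
  rw [← norm_iteratedFDeriv_one, norm_iteratedFDeriv_fderiv, norm_iteratedFDeriv_fderiv]
  exact h.spatial.bound 3 (by simp) t ht p

theorem abs_dt_le (h : Admissible T₀ T K c u) (ht : t ∈ Set.Ioo T₀ T) (ξ η : ℝ) :
    |dt u t ξ η| ≤ K := by
  have := h.spatial_dt.bound 0 (by simp) t ht (ξ, η)
  rwa [norm_iteratedFDeriv_zero] at this

theorem abs_dt_add_sub_le (h : Admissible T₀ T K c u) (ht : t ∈ Set.Ioo T₀ T) (ξ η a b : ℝ) :
    |dt u t (ξ + a) (η + b) - dt u t ξ η| ≤ K * ‖((a, b) : ℝ × ℝ)‖ := by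
  have := norm_sub_le_of_norm_fderiv_le (F := slice (dt u) t) (K := K)
    ((h.spatial_dt.contDiff t ht).of_le (by norm_num)) (fun p => by
      rw [← norm_iteratedFDeriv_one]
      exact h.spatial_dt.bound 1 (by simp) t ht p) (ξ, η) (ξ + a, η + b)
  simpa [slice] using this

theorem abs_dt_sub_le (h : Admissible T₀ T K c u) {t' : ℝ} (ht : t ∈ Set.Ioo T₀ T)
    (ht' : t' ∈ Set.Ioo T₀ T) (ξ η : ℝ) :
    |dt u t' ξ η - dt u t ξ η| ≤ K * |t' - t| :=
  (convex_Ioo T₀ T).norm_image_sub_le_of_norm_deriv_le (f := fun s => dt u s ξ η)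
    (fun s hs => h.differentiable_time_dt s hs ξ η) (fun s hs => h.bound_dtt s hs ξ η) ht ht'

/-- The mean value theorem needs only continuity at the endpoints, so `s = T₀` and `s' = T` are
allowed. -/
theorem exists_sub_eq_dt_mul (h : Admissible T₀ T K c u)
    (hc : ContinuousOn (fun z : ℝ × ℝ × ℝ => u z.1 z.2.1 z.2.2) (Set.Icc T₀ T ×ˢ Set.univ))
    {s s' : ℝ} (hs : T₀ ≤ s) (hss : s < s') (hs' : s' ≤ T) (ξ η : ℝ) :
    ∃ τ ∈ Set.Ioo s s', u s' ξ η - u s ξ η = dt u τ ξ η * (s' - s) := by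
  have hcont : ContinuousOn (fun τ => u τ ξ η) (Set.Icc s s') :=
    hc.comp (f := fun τ : ℝ => (τ, ξ, η)) (by fun_prop)
      fun τ hτ => ⟨⟨hs.trans hτ.1, hτ.2.trans hs'⟩, trivial⟩
  obtain ⟨τ, hτ, hd⟩ := exists_deriv_eq_slope (fun τ => u τ ξ η) hss hcont fun τ hτ =>
    (h.differentiable_time τ ⟨hs.trans_lt hτ.1, hτ.2.trans_le hs'⟩ ξ η).differentiableWithinAt
  refine ⟨τ, hτ, ?_⟩
  have : dt u τ ξ η = (u s' ξ η - u s ξ η) / (s' - s) := hd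
  rw [this, div_mul_cancel₀ _ (sub_pos.mpr hss).ne']

theorem abs_sub_time_le (h : Admissible T₀ T K c u)
    (hc : ContinuousOn (fun z : ℝ × ℝ × ℝ => u z.1 z.2.1 z.2.2) (Set.Icc T₀ T ×ˢ Set.univ))
    {s s' : ℝ} (hs : T₀ ≤ s) (hss : s < s') (hs' : s' ≤ T) (ξ η : ℝ) :
    |u s' ξ η - u s ξ η| ≤ K * (s' - s) := by
  obtain ⟨τ, hτ, he⟩ := h.exists_sub_eq_dt_mul hc hs hss hs' ξ η
  rw [he, abs_mul, abs_of_pos (sub_pos.mpr hss)]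
  exact mul_le_mul_of_nonneg_right (h.abs_dt_le ⟨hs.trans_lt hτ.1, hτ.2.trans_le hs'⟩ ξ η)
    (sub_pos.mpr hss).le

theorem abs_sub_time_sub_le (h : Admissible T₀ T K c u)
    (hc : ContinuousOn (fun z : ℝ × ℝ × ℝ => u z.1 z.2.1 z.2.2) (Set.Icc T₀ T ×ˢ Set.univ))
    {s s' : ℝ} (hs : T₀ < s) (hss : s < s') (hs' : s' < T) (ξ η : ℝ) :
    |u s' ξ η - u s ξ η - (s' - s) * dt u s ξ η| ≤ K * (s' - s) ^ 2 := by
  obtain ⟨τ, hτ, he⟩ := h.exists_sub_eq_dt_mul hc hs.le hss hs'.le ξ η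
  have hK : 0 ≤ K := (abs_nonneg _).trans (h.abs_dt_le ⟨hs, hss.trans hs'⟩ ξ η)
  have h1 := h.abs_dt_sub_le ⟨hs, hss.trans hs'⟩ ⟨hs.trans hτ.1, hτ.2.trans hs'⟩ ξ η
  have hp := sub_pos.mpr hss
  rw [abs_of_pos (sub_pos.mpr hτ.1)] at h1
  have h2 : u s' ξ η - u s ξ η - (s' - s) * dt u s ξ η
      = (dt u τ ξ η - dt u s ξ η) * (s' - s) := by rw [he]; ring
  rw [h2, abs_mul, abs_of_pos hp, pow_two, ← mul_assoc]
  refine mul_le_mul_of_nonneg_right (h1.trans (mul_le_mul_of_nonneg_left ?_ hK)) hp.le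
  linarith [hτ.2]

/-- At interior times the gradient terms of the two Taylor expansions cancel. The resulting
inequality involves values of `u` only, so it passes to `s = T` by continuity. -/
theorem second_difference_ge (h : Admissible T₀ T K c u)
    (hc : ContinuousOn (fun z : ℝ × ℝ × ℝ => u z.1 z.2.1 z.2.2) (Set.Icc T₀ T ×ˢ Set.univ))
    {s : ℝ} (hs : T₀ < s) (hs' : s ≤ T) (ξ η a b : ℝ) :
    2 * u s ξ η - 2 * (K * ‖((a, b) : ℝ × ℝ)‖ ^ 2)
      ≤ u s (ξ + a) (η + b) + u s (ξ - a) (η - b) := by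
  have hint : ∀ τ ∈ Set.Ioo T₀ T, 2 * u τ ξ η - 2 * (K * ‖((a, b) : ℝ × ℝ)‖ ^ 2)
      ≤ u τ (ξ + a) (η + b) + u τ (ξ - a) (η - b) := by
    intro τ hτ
    have h2 := (h.contDiff_slice hτ).of_le (m := 2) (by norm_num)
    have e1 := abs_le.mp (abs_taylor_one_le h2 (h.norm_fderiv_two_le hτ) (ξ, η) (a, b))
    have e2 := abs_le.mp (abs_taylor_one_le h2 (h.norm_fderiv_two_le hτ) (ξ, η) (-(a, b)))
    rw [norm_neg, map_neg] at e2
    have hm : ((ξ, η) : ℝ × ℝ) + -(a, b) = (ξ - a, η - b) := by simp [sub_eq_add_neg]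
    rw [hm] at e2
    simp only [slice, Prod.mk_add_mk] at e1 e2
    linarith [e1.1, e2.1]
  have hcl : s ∈ closure (Set.Ioo T₀ T) := by
    rw [closure_Ioo (hs.trans_le hs').ne]
    exact ⟨hs.le, hs'⟩
  have hcont : ∀ x y : ℝ, ContinuousWithinAt (fun τ => u τ x y) (Set.Ioo T₀ T) s := fun x y =>
    ((hc.comp (f := fun τ : ℝ => (τ, x, y)) (s := Set.Icc T₀ T) (by fun_prop)
      fun τ hτ => ⟨hτ, trivial⟩) s ⟨hs.le, hs'⟩).mono Set.Ioo_subset_Icc_self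
  exact ContinuousWithinAt.closure_le hcl
    (((hcont ξ η).const_mul 2).sub continuousWithinAt_const)
    ((hcont _ _).add (hcont _ _)) hint

/-- If both moves lost more than the stated amount, so would their average, whose loss is at most K
ε² in time and K (4ε)² in space; hence 17 = 1 + 16. No derivative at `s` or `s'` is needed, so the
step may start at T₀ or end at T. -/
theorem coarse_step (h : Admissible T₀ T K c u)
    (hc : ContinuousOn (fun z : ℝ × ℝ × ℝ => u z.1 z.2.1 z.2.2) (Set.Icc T₀ T ×ˢ Set.univ))
    {ε s s' : ℝ} (hε : 0 < ε) (hs : T₀ ≤ s) (hss : s' = s + ε ^ 2) (hs' : s' ≤ T)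
    {v w : ℝ} (hv : |v| ≤ 4) (hw : |w| ≤ 4) (hK : 0 ≤ K) (ξ η : ℝ) :
    ∃ b, u s ξ η - 17 * K * ε ^ 2 ≤ u s' (ξ + ε * sgn b * v) (η + ε * sgn b * w) := by
  have hε2 : 0 < ε ^ 2 := by positivity
  have h1 := abs_le.mp (h.abs_sub_time_le hc hs (by linarith : s < s') hs' ξ η)
  have h2 := h.second_difference_ge hc (by linarith : T₀ < s') hs' ξ η (ε * v) (ε * w)
  have hn : ‖((ε * v, ε * w) : ℝ × ℝ)‖ ≤ 4 * ε := by
    refine norm_prodMk_le ?_ ?_ <;> rw [abs_mul, abs_of_pos hε] <;> nlinarith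
  have h3 : K * ‖((ε * v, ε * w) : ℝ × ℝ)‖ ^ 2 ≤ K * (4 * ε) ^ 2 :=
    mul_le_mul_of_nonneg_left (pow_le_pow_left₀ (norm_nonneg _) hn 2) hK
  have h4 : s' - s = ε ^ 2 := by rw [hss]; ring
  rw [h4] at h1
  by_contra! hcon
  have ht := hcon true
  have hf := hcon false
  simp only [sgn, if_true, Bool.false_eq_true, if_false, mul_one, mul_neg, neg_mul,
    ← sub_eq_add_neg] at ht hf
  nlinarith [h1.1]

/-- The first variation of `u` in the direction `(v, w)` controls the deviation of the second
variation from that of the tangent direction. -/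
theorem abs_second_variation_sub_le (h : Admissible T₀ T K c u) (hc : 0 < c)
    (ht : t ∈ Set.Ioo T₀ T) {v w : ℝ} (hv : |v| ≤ 4) (hw : |w| ≤ 4) (ξ η : ℝ) :
    |fderiv ℝ (fderiv ℝ (slice u t)) (ξ, η) (v, w) (v, w)
        - v ^ 2 * ((hessian u t ξ η).mulVec (perpGrad u t ξ η) ⬝ᵥ perpGrad u t ξ η)|
      ≤ 8 * K / c * |v * dxi u t ξ η + w * deta u t ξ η| := by
  set B := fderiv ℝ (fderiv ℝ (slice u t)) (ξ, η) with hB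
  have hBn : ‖B‖ ≤ K := h.norm_fderiv_two_le ht _
  have hK : 0 ≤ K := (norm_nonneg _).trans hBn
  have hη := h.deta_gt t ht ξ η
  have hη0 := hc.trans hη
  have hξ := h.abs_dxi_le t ht ξ η
  set p := dxi u t ξ η
  set e := deta u t ξ η
  set z : ℝ × ℝ := (v, w)
  set z₀ : ℝ × ℝ := (v, -(v * (p / e)))
  have hratio : |p / e| ≤ 1 := by
    rw [abs_div, abs_of_pos hη0]
    exact div_le_one_of_le₀ hξ hη0.le
  have hz : ‖z‖ ≤ 4 := norm_prodMk_le hv hw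
  -- `z₀` is tangent to the level set of `u` and has the same ξ-component as `z`; the bound |u_ξ| ≤
  -- u_η keeps it as short as `z`.
  have hz₀ : ‖z₀‖ ≤ 4 := by
    refine norm_prodMk_le hv ?_
    rw [abs_neg, abs_mul]
    nlinarith [abs_nonneg v, abs_nonneg (p / e)]
  have hsub : ‖z - z₀‖ ≤ |v * p + w * e| / c := by
    have : z - z₀ = (0, (v * p + w * e) / e) := by
      simp only [z, z₀, Prod.mk_sub_mk, sub_self, Prod.mk.injEq, true_and]
      field_simp
      ring
    rw [this]
    refine norm_prodMk_le (by rw [abs_zero]; positivity) ?_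
    rw [abs_div, abs_of_pos hη0]
    exact div_le_div_of_nonneg_left (abs_nonneg _) hc hη.le
  have hform : v ^ 2 * ((hessian u t ξ η).mulVec (perpGrad u t ξ η) ⬝ᵥ perpGrad u t ξ η)
      = B z₀ z₀ := by
    rw [hessian_form_eq ((h.contDiff_slice ht).of_le (by norm_num))]
    have : z₀ = (-v) • ((perpGrad u t ξ η 0, perpGrad u t ξ η 1) : ℝ × ℝ) := by
      simp only [perpGrad, z₀, Pi.smul_apply, Matrix.cons_val_zero, Matrix.cons_val_one,
        smul_eq_mul, Prod.smul_mk, Prod.mk.injEq]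
      constructor
      · change v = -v * (e⁻¹ * -e)
        field_simp
      · change _ = -v * (e⁻¹ * p)
        field_simp
    rw [this]
    simp only [map_smul, smul_apply, smul_eq_mul]
    ring
  -- Each of the two terms has one factor `z - z₀` and one vector of norm at most 4, hence the
  -- constant 8 = 4 + 4.
  have hsplit : B z z - B z₀ z₀ = B (z - z₀) z + B z₀ (z - z₀) := by
    simp only [map_sub, sub_apply]
    ring
  have hb : ∀ x y, |B x y| ≤ K * ‖x‖ * ‖y‖ := fun x y =>
    (B.le_opNorm₂ x y).trans (by gcongr)
  rw [hform, hsplit]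
  calc |B (z - z₀) z + B z₀ (z - z₀)| ≤ |B (z - z₀) z| + |B z₀ (z - z₀)| := abs_add_le _ _
    _ ≤ K * ‖z - z₀‖ * ‖z‖ + K * ‖z₀‖ * ‖z - z₀‖ := add_le_add (hb _ _) (hb _ _)
    _ ≤ K * (|v * p + w * e| / c) * 4 + K * 4 * (|v * p + w * e| / c) := by gcongr
    _ = _ := by ring

/-- One step of the expansion of `u` in time and space along a market move. -/
theorem abs_expansion_le (h : Admissible T₀ T K c u)
    (hc : ContinuousOn (fun z : ℝ × ℝ × ℝ => u z.1 z.2.1 z.2.2) (Set.Icc T₀ T ×ˢ Set.univ))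
    {ε s s' : ℝ} (hε : 0 < ε) (hε1 : ε ≤ 1) (hs : T₀ < s) (hss : s' = s + ε ^ 2) (hs' : s' < T)
    {v w : ℝ} (hv : |v| ≤ 4) (hw : |w| ≤ 4) (ξ η : ℝ) (b : Bool) :
    |u s' (ξ + ε * sgn b * v) (η + ε * sgn b * w)
        - (u s ξ η + ε ^ 2 * dt u s ξ η
          + sgn b * (ε * (v * dxi u s ξ η + w * deta u s ξ η))
          + 1 / 2 * ε ^ 2 * fderiv ℝ (fderiv ℝ (slice u s)) (ξ, η) (v, w) (v, w))|
      ≤ 69 * K * ε ^ 3 ∧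
    |dt u s' (ξ + ε * sgn b * v) (η + ε * sgn b * w) - dt u s ξ η| ≤ 5 * K * ε := by
  have hε2 : 0 < ε ^ 2 := by positivity
  have hsT : s ∈ Set.Ioo T₀ T := ⟨hs, by linarith⟩
  have hsT' : s' ∈ Set.Ioo T₀ T := ⟨by linarith, hs'⟩
  have hK : 0 ≤ K := (abs_nonneg _).trans (h.abs_dt_le hsT ξ η)
  have hb : |sgn b| = 1 := by cases b <;> simp [sgn]
  have hb2 : sgn b ^ 2 = 1 := by cases b <;> simp [sgn]
  have h4 : s' - s = ε ^ 2 := by rw [hss]; ring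
  set k : ℝ × ℝ := (ε * sgn b * v, ε * sgn b * w) with hk
  have hkv : k = (ε * sgn b) • ((v, w) : ℝ × ℝ) := by simp [hk]
  have hn : ‖k‖ ≤ 4 * ε := by
    rw [hkv, norm_smul, Real.norm_eq_abs, abs_mul, hb, abs_of_pos hε, mul_one, mul_comm]
    exact mul_le_mul_of_nonneg_right (norm_prodMk_le hv hw) hε.le
  have e1 := abs_le.mp (h.abs_sub_time_sub_le hc hs (by linarith) hs'
    (ξ + ε * sgn b * v) (η + ε * sgn b * w))
  have e2 := abs_le.mp ((h.abs_dt_add_sub_le hsT ξ η (ε * sgn b * v) (ε * sgn b * w)).trans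
    (mul_le_mul_of_nonneg_left hn hK))
  have e3 := abs_le.mp (h.abs_dt_sub_le hsT hsT' (ξ + ε * sgn b * v) (η + ε * sgn b * w))
  have e4 := abs_le.mp ((abs_taylor_two_le (h.contDiff_slice hsT) (h.norm_fderiv_three_le hsT)
    (ξ, η) k).trans (mul_le_mul_of_nonneg_left (pow_le_pow_left₀ (norm_nonneg _) hn 3) hK))
  rw [hkv, fderiv_slice_apply ((h.contDiff_slice hsT).differentiable (by norm_num)),
    ← hkv] at e4
  have hq : fderiv ℝ (fderiv ℝ (slice u s)) (ξ, η) k k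
      = ε ^ 2 * fderiv ℝ (fderiv ℝ (slice u s)) (ξ, η) (v, w) (v, w) := by
    rw [hkv]
    simp only [map_smul, smul_apply, smul_eq_mul]
    linear_combination ε ^ 2 * fderiv ℝ (fderiv ℝ (slice u s)) (ξ, η) (v, w) (v, w) * hb2
  rw [hq] at e4
  simp only [slice, hk, Prod.mk_add_mk] at e4
  rw [h4] at e1
  rw [h4, abs_of_pos hε2] at e3
  have hle2 : K * ε ^ 2 ≤ K * ε := mul_le_mul_of_nonneg_left (by nlinarith) hK
  have hle4 : K * (ε ^ 2) ^ 2 ≤ K * ε ^ 3 := by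
    refine mul_le_mul_of_nonneg_left ?_ hK
    nlinarith [pow_pos hε 3]
  have m1 := mul_le_mul_of_nonneg_left e2.1 hε2.le
  have m2 := mul_le_mul_of_nonneg_left e2.2 hε2.le
  -- The 69 is 64 from the cubic remainder at distance 4ε, 4 from shifting u_t in space, and 1 from
  -- the quadratic remainder in time. The 5 is 4 from the shift of u_t in space and 1 from the shift
  -- in time.
  constructor
  · rw [abs_le]
    constructor <;> linarith [e1.1, e1.2, e4.1, e4.2]
  · rw [abs_le]
    constructor <;> linarith [e2.1, e2.2, e3.1, e3.2]

/-- The market has a move that keeps the corrected function from decreasing by more than a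
multiple of `ε ^ 3`. -/
theorem fine_step (h : Admissible T₀ T K c u) (hc : 0 < c) {A : ℝ} {φ : ℝ → ℝ → ℝ}
    (hu : SolvesPDE A T₀ T φ u) (hA : 0 < A)
    {ε s s' : ℝ} (hε : 0 < ε) (hε1 : ε ≤ 1) (hεc : 4 * K * ε ≤ c)
    (hs : T₀ < s) (hss : s' = s + ε ^ 2) (hs' : s' < T)
    {v w : ℝ} (hv : |v| ≤ 4) (hw : |w| ≤ 4) {B a₀ : ℝ} {a : Bool → ℝ} (haB : ∀ b, |a b| ≤ B)
    (ha : (a true + a false) / 2 - a₀ = 1 - v ^ 2 / A) (ξ η : ℝ) :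
    ∃ b, u s ξ η - ε ^ 2 * dt u s ξ η * a₀ - (4 * K ^ 2 * B / c + (69 + 5 * B) * K) * ε ^ 3
      ≤ u s' (ξ + ε * sgn b * v) (η + ε * sgn b * w)
        - ε ^ 2 * dt u s' (ξ + ε * sgn b * v) (η + ε * sgn b * w) * a b := by
  have hε2 : 0 < ε ^ 2 := by positivity
  have hsT : s ∈ Set.Ioo T₀ T := ⟨hs, by linarith⟩
  have hD := h.abs_dt_le hsT ξ η
  have hK : 0 ≤ K := (abs_nonneg _).trans hD
  have hB : 0 ≤ B := (abs_nonneg _).trans (haB true)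
  have hpde := hu.equation s hsT ξ η
  have hQ := h.abs_second_variation_sub_le hc hsT hv hw ξ η
  have hexp := h.abs_expansion_le hu.continuousOn hε hε1 hs hss hs' hv hw ξ η
  set D := dt u s ξ η
  set G := v * dxi u s ξ η + w * deta u s ξ η
  set Q := fderiv ℝ (fderiv ℝ (slice u s)) (ξ, η) (v, w) (v, w)
  set H := (hessian u s ξ η).mulVec (perpGrad u s ξ η) ⬝ᵥ perpGrad u s ξ η
  have hH : 1 / 2 * (v ^ 2 * H) = -(D * (v ^ 2 / A)) := by
    have : D = -(1 / 2 * A * H) := by linarith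
    rw [this]
    field_simp
  set β := (a true - a false) / 2 with hβ
  -- `X` collects everything odd in the move: the first variation of `u` and the odd part of the
  -- corrector.
  set X := ε * G - ε ^ 2 * D * β with hX
  have hβB : |β| ≤ B := by
    have h1 := abs_le.mp (haB true)
    have h2 := abs_le.mp (haB false)
    rw [hβ, abs_le]
    constructor <;> linarith [h1.1, h1.2, h2.1, h2.2]
  have hDβ : |D * β| ≤ K * B := by
    rw [abs_mul]
    exact mul_le_mul hD hβB (abs_nonneg _) hK
  have hG : ε * |G| ≤ |X| + ε ^ 2 * (K * B) := by
    have h1 : ε * G = X + ε ^ 2 * (D * β) := by rw [hX]; ring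
    calc ε * |G| = |ε * G| := by rw [abs_mul, abs_of_pos hε]
      _ ≤ |X| + |ε ^ 2 * (D * β)| := by rw [h1]; exact abs_add_le _ _
      _ ≤ _ := by
        rw [abs_mul, abs_of_pos hε2]
        linarith [mul_le_mul_of_nonneg_left hDβ hε2.le]
  obtain ⟨b, hbX⟩ : ∃ b, sgn b * X = |X| := by
    rcases le_total 0 X with hX0 | hX0
    · exact ⟨true, by simp [sgn, abs_of_nonneg hX0]⟩
    · exact ⟨false, by simp [sgn, abs_of_nonpos hX0]⟩
  refine ⟨b, ?_⟩
  have hab : a b = a₀ + 1 - v ^ 2 / A + sgn b * β := by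
    cases b <;> simp [sgn, hβ] <;> linarith
  obtain ⟨e1, e2⟩ := hexp b
  have e1' := (abs_le.mp e1).1
  set U := u s' (ξ + ε * sgn b * v) (η + ε * sgn b * w)
  set D' := dt u s' (ξ + ε * sgn b * v) (η + ε * sgn b * w)
  have e3 : (D' - D) * a b ≤ 5 * K * ε * B := by
    refine (le_abs_self _).trans ?_
    rw [abs_mul]
    exact mul_le_mul e2 (haB b) (abs_nonneg _) (by positivity)
  have e4 := mul_le_mul_of_nonneg_left e3 hε2.le
  have e5 : 1 / 2 * ε ^ 2 * (v ^ 2 * H) - 4 * K / c * ε ^ 2 * |G| ≤ 1 / 2 * ε ^ 2 * Q := by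
    have := mul_le_mul_of_nonneg_left (abs_le.mp hQ).1 hε2.le
    have h2 : ε ^ 2 * (8 * K / c * |G|) = 2 * (4 * K / c * ε ^ 2 * |G|) := by ring
    linarith
  -- The gain |X| pays for leaving the tangent direction; this is where `4 * K * ε ≤ c` is needed.
  have e6 : 4 * K / c * ε ^ 2 * |G| ≤ |X| + 4 * K ^ 2 * B / c * ε ^ 3 := by
    have hle : 4 * K * ε / c ≤ 1 := div_le_one_of_le₀ hεc hc.le
    have h0 : 0 ≤ 4 * K * ε / c := by positivity
    calc 4 * K / c * ε ^ 2 * |G| = 4 * K * ε / c * (ε * |G|) := by ring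
      _ ≤ 4 * K * ε / c * (|X| + ε ^ 2 * (K * B)) := mul_le_mul_of_nonneg_left hG h0
      _ = 4 * K * ε / c * |X| + 4 * K ^ 2 * B / c * ε ^ 3 := by ring
      _ ≤ _ := by
        have := mul_le_mul_of_nonneg_right hle (abs_nonneg X)
        linarith
  have hH' : 1 / 2 * ε ^ 2 * (v ^ 2 * H) = -(ε ^ 2 * D * (v ^ 2 / A)) := by
    linear_combination ε ^ 2 * hH
  have e7 : ε ^ 2 * D * a b = ε ^ 2 * D * a₀ + ε ^ 2 * D - ε ^ 2 * D * (v ^ 2 / A)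
      + sgn b * (ε * G) - |X| := by
    rw [← hbX, hX, hab]
    ring
  have e8 : ε ^ 2 * D' * a b = ε ^ 2 * ((D' - D) * a b) + ε ^ 2 * D * a b := by ring
  rw [e8, e7]
  have e9 : (4 * K ^ 2 * B / c + (69 + 5 * B) * K) * ε ^ 3
      = 4 * K ^ 2 * B / c * ε ^ 3 + 69 * K * ε ^ 3 + ε ^ 2 * (5 * K * ε * B) := by ring
  rw [e9]
  linarith

end Admissible

end Estimates

/-! ### The lower bound for the value function -/

section LowerBound

variable {d : ℕ}

theorem le_value_succ {q r : State d → ℝ} {φ : ℝ → ℝ → ℝ} {ε : ℝ} {n : ℕ} {m : State d}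
    {ξ η L : ℝ}
    (h : ∀ f ∈ Set.Icc (-1 : ℝ) 1, ∃ b, L ≤ value q r φ ε n (next m b)
      (ξ + ε * sgn b * (q m - r m)) (η + ε * sgn b * (q m + r m - 2 * f))) :
    L ≤ value q r φ ε (n + 1) m ξ η := by
  rw [value]
  refine le_csInf (Set.Nonempty.image _ ⟨0, by simp⟩) ?_
  rintro _ ⟨f, hf, rfl⟩
  obtain ⟨b, hb⟩ := h f hf
  cases b
  · exact hb.trans (le_max_right _ _)
  · exact hb.trans (le_max_left _ _)

theorem Experts.abs_moves_le {q r : State d → ℝ} (hqr : Experts q r) (m : State d) {f : ℝ}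
    (hf : f ∈ Set.Icc (-1 : ℝ) 1) : |q m - r m| ≤ 4 ∧ |q m + r m - 2 * f| ≤ 4 := by
  have h1 := abs_lt.mp (hqr.abs_q_lt_one m)
  have h2 := abs_lt.mp (hqr.abs_r_lt_one m)
  constructor <;> rw [abs_le] <;> constructor <;> linarith [h1.1, h1.2, h2.1, h2.2, hf.1, hf.2]

variable {q r : State d → ℝ} {T₀ T K c ε : ℝ} {φ : ℝ → ℝ → ℝ} {u : ℝ → ℝ → ℝ → ℝ}

theorem le_value_succ_of_le (hqr : Experts q r) (h : Admissible T₀ T K c u) (hK : 0 ≤ K)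
    (hc : ContinuousOn (fun z : ℝ × ℝ × ℝ => u z.1 z.2.1 z.2.2) (Set.Icc T₀ T ×ˢ Set.univ))
    (hε : 0 < ε) {s s' δ : ℝ} (hs : T₀ ≤ s) (hss : s' = s + ε ^ 2) (hs' : s' ≤ T) {n : ℕ}
    (hn : ∀ m ξ η, u s' ξ η - δ ≤ value q r φ ε n m ξ η) (m : State d) (ξ η : ℝ) :
    u s ξ η - (δ + 17 * K * ε ^ 2) ≤ value q r φ ε (n + 1) m ξ η := by
  refine le_value_succ fun f hf => ?_
  obtain ⟨hv, hw⟩ := hqr.abs_moves_le m hf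
  obtain ⟨b, hb⟩ := h.coarse_step hc hε hs hss hs' hv hw hK ξ η
  have := hn (next m b) (ξ + ε * sgn b * (q m - r m)) (η + ε * sgn b * (q m + r m - 2 * f))
  exact ⟨b, by linarith⟩

/-- The induction starts at `n = 1` because u_t is not controlled at time T, so the corrected
function cannot be used there. The first step is coarse (17) and then inserts the corrector (`B`);
each later step is fine. -/
theorem le_value_of_interior (hqr : Experts q r) (hcpos : 0 < c) (h : Admissible T₀ T K c u)
    (hK : 0 ≤ K) (hu : SolvesPDE (mean (gap q r)) T₀ T φ u) (hε : 0 < ε) (hε1 : ε ≤ 1)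
    (hεc : 4 * K * ε ≤ c) {B : ℝ} {a : State d → ℝ} (haB : ∀ m, |a m| ≤ B)
    (ha : ∀ m, walkAverage a m - a m = 1 - gap q r m / mean (gap q r)) {n : ℕ} (hn : 1 ≤ n) :
    T₀ < T - n * ε ^ 2 → ∀ (m : State d) (ξ η : ℝ),
      u (T - n * ε ^ 2) ξ η - ε ^ 2 * dt u (T - n * ε ^ 2) ξ η * a m
        - ((17 + B) * K * ε ^ 2 + n * ((4 * K ^ 2 * B / c + (69 + 5 * B) * K) * ε ^ 3))
      ≤ value q r φ ε n m ξ η := by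
  have hε2 : 0 < ε ^ 2 := by positivity
  have hA := mean_gap_pos hqr
  have hB : ∀ _ : State d, 0 ≤ B := fun m => (abs_nonneg _).trans (haB m)
  induction n, hn using Nat.le_induction with
  | base =>
    intro hT m ξ η
    rw [Nat.cast_one, one_mul] at hT ⊢
    have h1 := le_value_succ_of_le (φ := φ) (δ := 0) (n := 0) hqr h hK hu.continuousOn hε hT.le
      (sub_add_cancel T _).symm le_rfl
      (fun m ξ η => by rw [value, hu.final, sub_zero]) m ξ η
    have h2 : |dt u (T - ε ^ 2) ξ η * a m| ≤ K * B := by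
      rw [abs_mul]
      exact mul_le_mul (h.abs_dt_le ⟨hT, by linarith⟩ ξ η) (haB m) (abs_nonneg _) hK
    have h3 := mul_le_mul_of_nonneg_left (abs_le.mp h2).1 hε2.le
    have h4 : 0 ≤ (4 * K ^ 2 * B / c + (69 + 5 * B) * K) * ε ^ 3 := by
      have := hB m
      positivity
    linarith
  | succ n hn ih =>
    intro hT m ξ η
    push_cast at hT ⊢
    have hn0 : (1 : ℝ) ≤ n := by exact_mod_cast hn
    have hT' : T₀ < T - n * ε ^ 2 := by linarith
    refine le_value_succ fun f hf => ?_
    obtain ⟨hv, hw⟩ := hqr.abs_moves_le m hf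
    obtain ⟨b, hb⟩ := h.fine_step hcpos hu hA hε hε1 hεc hT
      (s' := T - n * ε ^ 2) (by ring) (by nlinarith) hv hw (a := fun b => a (next m b))
      (fun b => haB _) (ha m) ξ η
    refine ⟨b, le_trans ?_ (ih hT' (next m b) _ _)⟩
    linarith

end LowerBound

end StockGame

/-! ### Choice of constants and the steps at T and T₀ -/

theorem mainTheorem2 (d : ℕ) (hd : 1 ≤ d) (K c : ℝ) (hc : 0 < c) :
    ∃ C ε₀ : ℝ, 0 < ε₀ ∧
      ∀ q r : StockGame.State d → ℝ, StockGame.Experts q r →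
      ∀ T₀ T : ℝ, T₀ < T →
      ∀ (φ : ℝ → ℝ → ℝ) (u : ℝ → ℝ → ℝ → ℝ),
        StockGame.SolvesPDE (StockGame.marketValue q r) T₀ T φ u →
        StockGame.Admissible T₀ T K c u →
      ∀ ε : ℝ, 0 < ε → ε < ε₀ →
      ∀ (t : ℝ) (N : ℕ), T₀ ≤ t → t < T → (T - t) / ε ^ 2 = N →
      ∀ (m : StockGame.State d) (ξ η : ℝ),
        StockGame.value q r φ ε N m ξ η ≥ u t ξ η - C * ((T - t) + ε) * ε := by
  open StockGame in
  have : NeZero d := ⟨by omega⟩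
  set B : ℝ := d * 2 ^ d with hBdef
  have hB : 0 ≤ B := by positivity
  -- 34 = 2 · 17 allows for one coarse step at T and one at T₀; `2 * B` is for inserting and
  -- removing the corrector. The remainder is the loss per fine step in units of ε³. Absolute values
  -- are taken because `K ≥ 0` follows only once an admissible `u` is given.
  refine ⟨(34 + 2 * B) * |K| + (4 * K ^ 2 * B / c + (69 + 5 * B) * |K|),
    min 1 (c / (4 * |K| + 1)), by positivity, ?_⟩
  intro q r hqr T₀ T hT φ u hu h ε hε hε₀ t N ht htT hN m ξ η
  have hK : 0 ≤ K := (abs_nonneg _).trans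
    (h.bound_dtt ((T₀ + T) / 2) ⟨by linarith, by linarith⟩ 0 0)
  rw [abs_of_nonneg hK] at hε₀ ⊢
  have hε1 : ε ≤ 1 := (hε₀.trans_le (min_le_left _ _)).le
  have hεc : 4 * K * ε ≤ c := by
    have h1 := (lt_div_iff₀ (by positivity)).mp (hε₀.trans_le (min_le_right _ _))
    linarith
  have hε2 : 0 < ε ^ 2 := by positivity
  rw [marketValue_eq_mean hqr] at hu
  obtain ⟨a, haB, ha⟩ := exists_corrector hqr
  rw [← hBdef] at haB
  set C₂ := 4 * K ^ 2 * B / c + (69 + 5 * B) * K with hC₂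
  have hC₂0 : 0 ≤ C₂ := by positivity
  have hN' : T - t = N * ε ^ 2 := (div_eq_iff hε2.ne').mp hN
  have hint : ∀ n : ℕ, 1 ≤ n → T₀ < T - n * ε ^ 2 → ∀ (m : State d) (ξ η : ℝ),
      u (T - n * ε ^ 2) ξ η - ((17 + 2 * B) * K * ε ^ 2 + n * (C₂ * ε ^ 3))
        ≤ value q r φ ε n m ξ η := by
    intro n hn hTn m ξ η
    have h1 := le_value_of_interior hqr hc h hK hu hε hε1 hεc haB ha hn hTn m ξ η
    have hn0 : (1 : ℝ) ≤ n := by exact_mod_cast hn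
    have h2 : |dt u (T - n * ε ^ 2) ξ η * a m| ≤ K * B := by
      rw [abs_mul]
      exact mul_le_mul (h.abs_dt_le ⟨hTn, by nlinarith⟩ ξ η) (haB m) (abs_nonneg _) hK
    have h3 := mul_le_mul_of_nonneg_left (abs_le.mp h2).2 hε2.le
    rw [← hC₂] at h1
    linarith
  have hcases : ∀ δ : ℝ, δ ≤ (34 + 2 * B) * K * ε ^ 2 + N * (C₂ * ε ^ 3) →
      u t ξ η - δ ≤ value q r φ ε N m ξ η →
      value q r φ ε N m ξ η ≥ u t ξ η - ((34 + 2 * B) * K + C₂) * ((T - t) + ε) * ε := by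
    intro δ hδ hval
    have h1 : ((34 + 2 * B) * K + C₂) * ((T - t) + ε) * ε
        = (34 + 2 * B) * K * (T - t) * ε + (34 + 2 * B) * K * ε ^ 2 + N * (C₂ * ε ^ 3)
          + C₂ * ε ^ 2 := by
      rw [hN']
      ring
    have h2 : 0 ≤ (34 + 2 * B) * K * (T - t) * ε :=
      mul_nonneg (mul_nonneg (by positivity) (by linarith)) hε.le
    have h3 : 0 ≤ C₂ * ε ^ 2 := by positivity
    linarith
  have hKε : 0 ≤ K * ε ^ 2 := by positivity
  have hBKε : 0 ≤ B * K * ε ^ 2 := by positivity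
  have hCε : 0 ≤ C₂ * ε ^ 3 := by positivity
  have htN : t = T - N * ε ^ 2 := by linarith
  rcases ht.lt_or_eq with ht' | ht'
  · have hN1 : 1 ≤ N := by
      rcases Nat.eq_zero_or_pos N with rfl | hpos
      · simp at hN'
        linarith
      · exact hpos
    refine hcases _ ?_ (htN ▸ hint N hN1 (htN ▸ ht') m ξ η)
    linarith
  -- Here `t = T₀`, so the last step back in time is coarse. For one step it starts directly from
  -- the final data; otherwise it follows an interior bound with at least one step.
  · obtain _ | _ | n := N
    · simp at hN'
      linarith
    · refine hcases _ ?_ (le_value_succ_of_le (δ := 0) hqr h hK hu.continuousOn hε ht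
        (s' := T) (by rw [htN]; push_cast; ring) le_rfl
        (fun m ξ η => by rw [value, hu.final, sub_zero]) m ξ η)
      push_cast
      linarith
    · push_cast at htN
      refine hcases _ ?_ (le_value_succ_of_le hqr h hK hu.continuousOn hε ht
        (s' := T - (n + 1 : ℕ) * ε ^ 2) (by rw [htN]; push_cast; ring)
        (by push_cast; nlinarith [(Nat.cast_nonneg n : (0 : ℝ) ≤ n)])
        (hint (n + 1) (by omega) (by push_cast; linarith)) m ξ η)
      push_cast
      linarith
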